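/- Let $\langle x,y\rangle=x_1y_1+x_2y_2+x_3y_3+x_4y_4-x_5y_5$ be the Lorentz form on $\mathbb R^5$ and let $\Lambda^4=\{x\in\mathbb R^5:\langle x,x\rangle=1\}$ be de Sitter space. Let $\sigma:\mathbb R/T\mathbb Z\to\Lambda^4$ $(T>0)$ be a closed space-like curve of class $C^2$, that is, $\langle\sigma'(t),\sigma'(t)\rangle>0$ for all $t$. Let $s(t)=\int_0^t\langle\sigma',\sigma'\rangle^{1/2}$ be its arc-length parameter, let $\ell=s(T)$ be its Lorentzian length, and let $\vec k_g=\sigma+\ddot\sigma$ be its geodesic curvature vector, dots denoting derivatives with respect to $s$. Suppose that $\vec k_g$ never vanishes and is nowhere space-like: $\vec k_g\ne0$ and $\langle\vec k_g,\vec k_g\rangle\le0$ at every point. Then: 1. $\ell\ge2\pi$. 2. $\ell=2\pi$ if and only if $\mathrm{span}(\vec k_g)$ is light-like (that is, $\langle\vec k_g,\vec k_g\rangle=0$ at every point) and constant along the curve, and the curve is simple, i.e. $\sigma$ is injective on $\mathbb R/T\mathbb Z$. 3. $\mathrm{span}(\vec k_g)$ is light-like and constant if and only if, in the arc-length parameter,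 $\sigma(s)=\lambda(s)\,u+\cos s\;v+\sin s\;w$ for some pairwise orthogonal vectors $u,v,w\in\mathbb R^5$ with $u\neq0$, $\langle u,u\rangle=0$, $\langle v,v\rangle=\langle w,w\rangle=1$, and some $\ell$-periodic $C^2$ function $\lambda:\mathbb R\to\mathbb R$. In this case $\ell=2\pi k$ for some integer $k\ge1$. -/

import Mathlib

noncomputable section

namespace DeSitter

/-- The Lorentz bilinear form `x₁y₁ + x₂y₂ + x₃y₃ + x₄y₄ - x₅y₅` on `ℝ⁵`. -/
def lorentz (x y : Fin 5 → ℝ) : ℝ :=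
  x 0 * y 0 + x 1 * y 1 + x 2 * y 2 + x 3 * y 3 - x 4 * y 4

/-- De Sitter space `Λ⁴`, the unit quadric of the Lorentz form. -/
def deSitterSpace : Set (Fin 5 → ℝ) := {x | lorentz x x = 1}

/-- A light-like vector: nonzero and null. -/
def IsLightlike (x : Fin 5 → ℝ) : Prop := x ≠ 0 ∧ lorentz x x = 0

/-- A closed space-like curve in de Sitter space, written as a `T`-periodic map on `ℝ` in an
arbitrary regular parameter; it is the closed curve `ℝ / Tℤ → Λ⁴`. The period `T` need not be the
least one, so curves that are run through several times are included. -/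
structure IsClosedSpacelikeCurve (T : ℝ) (σ : ℝ → Fin 5 → ℝ) : Prop where
  period_pos : 0 < T
  contDiff : ContDiff ℝ 2 σ
  periodic : Function.Periodic σ T
  mem : ∀ t, σ t ∈ deSitterSpace
  spacelike : ∀ t, 0 < lorentz (deriv σ t) (deriv σ t)

/-- The Lorentzian speed `‖σ'(t)‖` of a space-like curve. -/
def speed (σ : ℝ → Fin 5 → ℝ) (t : ℝ) : ℝ := √(lorentz (deriv σ t) (deriv σ t))

/-- The arc-length parameter `s(t)` along `σ`, counted from `t = 0`. -/
def arcLength (σ : ℝ → Fin 5 → ℝ) (t : ℝ) : ℝ := ∫ x in (0 : ℝ)..t, speed σ x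

/-- The derivative of `f` with respect to the arc-length parameter of `σ`. -/
def arcDeriv (σ f : ℝ → Fin 5 → ℝ) (t : ℝ) : Fin 5 → ℝ := (speed σ t)⁻¹ • deriv f t

/-- The geodesic curvature vector `k_g = σ + σ̈`, dots being arc-length derivatives. -/
def geodesicCurvature (σ : ℝ → Fin 5 → ℝ) (t : ℝ) : Fin 5 → ℝ :=
  σ t + arcDeriv σ (arcDeriv σ σ) t

/-- Almost regular: the geodesic curvature vector never vanishes and is never space-like. -/
def IsAlmostRegular (σ : ℝ → Fin 5 → ℝ) : Prop :=
  ∀ t, geodesicCurvature σ t ≠ 0 ∧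
    lorentz (geodesicCurvature σ t) (geodesicCurvature σ t) ≤ 0

/-- The Lorentzian length of a closed curve of period `T`. -/
def length (T : ℝ) (σ : ℝ → Fin 5 → ℝ) : ℝ := arcLength σ T

/-- `span (k_g)` is light-like and constant along the curve. -/
def HasConstantLightlikeCurvatureLine (σ : ℝ → Fin 5 → ℝ) : Prop :=
  (∀ t, IsLightlike (geodesicCurvature σ t)) ∧
    ∀ t₁ t₂, Submodule.span ℝ {geodesicCurvature σ t₁} = Submodule.span ℝ {geodesicCurvature σ t₂}

/-- In the arc-length parameter `s`, the curve is `lam(s) u + cos s v + sin s w`, where `u, v, w`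
are pairwise orthogonal, `u` is light-like, `v, w` are unit space-like, and the function `lam` is
periodic with period the length of the curve. -/
def HasDrillForm (T : ℝ) (σ : ℝ → Fin 5 → ℝ) : Prop :=
  ∃ (lam : ℝ → ℝ) (u v w : Fin 5 → ℝ),
    ContDiff ℝ 2 lam ∧ Function.Periodic lam (length T σ) ∧
    IsLightlike u ∧ lorentz v v = 1 ∧ lorentz w w = 1 ∧
    lorentz u v = 0 ∧ lorentz u w = 0 ∧ lorentz v w = 0 ∧
    ∀ t, σ t = lam (arcLength σ t) • u + Real.cos (arcLength σ t) • v +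
      Real.sin (arcLength σ t) • w

/-- The closed curve `ℝ / Tℤ → Λ⁴` is simple, that is, injective. -/
def IsSimpleClosed (T : ℝ) (σ : ℝ → Fin 5 → ℝ) : Prop := Set.InjOn σ (Set.Ico 0 T)

end DeSitter

end

open Real Set Filter Topology intervalIntegral

namespace DeSitter

/-! ### Second order inequalities on the line -/

/-! Write γ for the curve in arc length, K = γ + γ'' and N = ∫ K over one period. The nonzero causal
vectors K stay by continuity in one half of the light cone, so ⟨K s, K r⟩ ≤ 0 for all s, r, and N is
a nonzero causal vector. Since γ'' has zero integral, also N = ∫ γ.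

If N is null, then ⟨K, N⟩ ≤ 0 has integral ⟨N, N⟩ = 0 and vanishes identically, so every K s is a
multiple of N. Then γ'' + γ lies in a fixed null line, and γ is a unit circle plus a multiple of N.
Closing up forces the length to be a multiple of 2π.

If N is time-like, the length l exceeds 2π. Suppose l ≤ 2π. The function f = -⟨γ, K r⟩ satisfies f''
+ f ≥ 0 and has a double zero at r; Sturm comparison makes it nonnegative within distance π of r,
hence on the whole curve. Integrating in r gives ⟨γ, N⟩ ≤ 0, so ⟨γ, N⟩⟨K, N⟩ ≥ 0. By parts, the
integral of this product is ∫ ⟨γ, N⟩² - ∫ ⟨γ', N⟩². The projection of γ to the Euclidean space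
orthogonal to N has mean zero, and Wirtinger's inequality for it says that this difference is ≤ 0.
So the product vanishes identically; as ⟨K, N⟩ ≠ 0, this gives ⟨γ, N⟩ = 0 and then ⟨K, N⟩ = 0, a
contradiction. -/

/-- Sturm comparison, to the right of a double zero. -/
theorem nonneg_of_deriv2_add_nonneg_right {f f' f'' : ℝ → ℝ}
    (h1 : ∀ s, HasDerivAt f (f' s) s) (h2 : ∀ s, HasDerivAt f' (f'' s) s)
    (hg : ∀ s, 0 ≤ f'' s + f s) {a s : ℝ} (ha : f a = 0) (ha' : f' a = 0)
    (has : a ≤ s) (hs : s ≤ a + π) : 0 ≤ f s := by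
  -- Wronskian of f with r ↦ sin (s - r): it is 0 at r = a by the double zero, and f s at r = s.
  have hd : ∀ r, HasDerivAt (fun r => f' r * sin (s - r) + f r * cos (s - r))
      ((f'' r + f r) * sin (s - r)) r := by
    intro r
    have hr : HasDerivAt (fun r => s - r) (-1) r := (hasDerivAt_id r).const_sub s
    exact (((h2 r).mul hr.sin).add ((h1 r).mul hr.cos)).congr_deriv (by ring)
  have hm : MonotoneOn (fun r => f' r * sin (s - r) + f r * cos (s - r)) (Icc a s) := by
    refine monotoneOn_of_deriv_nonneg (convex_Icc a s)
      (fun r _ => (hd r).continuousAt.continuousWithinAt)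
      (fun r _ => (hd r).differentiableAt.differentiableWithinAt) fun r hr => ?_
    rw [interior_Icc] at hr
    rw [(hd r).deriv]
    exact mul_nonneg (hg r)
      (sin_nonneg_of_nonneg_of_le_pi (by linarith [hr.2]) (by linarith [hr.1]))
  have := hm (left_mem_Icc.2 has) (right_mem_Icc.2 has) has
  simpa [ha, ha'] using this

/-- Sturm comparison, on both sides of a double zero. -/
theorem nonneg_of_deriv2_add_nonneg {f f' f'' : ℝ → ℝ}
    (h1 : ∀ s, HasDerivAt f (f' s) s) (h2 : ∀ s, HasDerivAt f' (f'' s) s)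
    (hg : ∀ s, 0 ≤ f'' s + f s) {a s : ℝ} (ha : f a = 0) (ha' : f' a = 0)
    (hs : |s - a| ≤ π) : 0 ≤ f s := by
  rw [abs_le] at hs
  rcases le_total a s with h | h
  · exact nonneg_of_deriv2_add_nonneg_right h1 h2 hg ha ha' h (by linarith)
  · have hneg : ∀ r : ℝ, HasDerivAt (fun r : ℝ => -r) (-1) r := fun r => (hasDerivAt_id r).neg
    have := nonneg_of_deriv2_add_nonneg_right (f := fun r => f (-r)) (f' := fun r => -f' (-r))
      (f'' := fun r => f'' (-r)) (a := -a) (s := -s)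
      (fun r => ((h1 (-r)).comp r (hneg r)).congr_deriv (by ring))
      (fun r => ((h2 (-r)).comp r (hneg r)).neg.congr_deriv (by ring))
      (fun r => hg (-r)) (by simpa using ha) (by simpa using ha') (by linarith) (by linarith)
    simpa using this

/-- The only solution of `f'' + f = 0` with a double zero is zero. -/
theorem eq_zero_of_deriv2_add_eq_zero {f f' f'' : ℝ → ℝ}
    (h1 : ∀ s, HasDerivAt f (f' s) s) (h2 : ∀ s, HasDerivAt f' (f'' s) s)
    (hg : ∀ s, f'' s + f s = 0) {a : ℝ} (ha : f a = 0) (ha' : f' a = 0) (s : ℝ) : f s = 0 := by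
  have hd : ∀ r, HasDerivAt (fun r => f r ^ 2 + f' r ^ 2) 0 r := by
    intro r
    refine (((h1 r).pow 2).add ((h2 r).pow 2)).congr_deriv ?_
    push_cast
    linear_combination 2 * f' r * hg r
  have := is_const_of_deriv_eq_zero (fun r => (hd r).differentiableAt) (fun r => (hd r).deriv) s a
  simp only [ha, ha'] at this
  nlinarith [sq_nonneg (f s), sq_nonneg (f' s)]

/-! ### Wirtinger's inequality -/

/-- Completing the square with the Riccati solution c tan (c (s - m)): g'² - c² g² differs from a
square by the derivative of c g² tan, whose boundary terms vanish. Taking c < 1 keeps the tangent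
finite on the closed interval even when its length is π. -/
theorem sq_mul_integral_sq_le {g g' : ℝ → ℝ} (h1 : ∀ s, HasDerivAt g (g' s) s)
    (hc' : Continuous g') {a b c : ℝ} (hab : a ≤ b) (hL : b - a ≤ π) (ga : g a = 0) (gb : g b = 0)
    (hc : 0 < c) (hc1 : c < 1) : c ^ 2 * (∫ s in a..b, g s ^ 2) ≤ ∫ s in a..b, g' s ^ 2 := by
  have hcg : Continuous g := continuous_iff_continuousAt.2 fun s => (h1 s).continuousAt
  set m := (a + b) / 2 with hm
  have hcont : Continuous fun s => g' s ^ 2 - c ^ 2 * g s ^ 2 := by fun_prop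
  have hcos : ∀ s ∈ Icc a b, 0 < cos (c * (s - m)) := by
    intro s hs
    have : |c * (s - m)| < π / 2 := by
      have h3 : |s - m| ≤ π / 2 := by
        rw [abs_le]; constructor <;> linarith [hs.1, hs.2]
      rw [abs_mul, abs_of_pos hc]
      nlinarith [pi_pos, abs_nonneg (s - m)]
    rw [abs_lt] at this
    exact cos_pos_of_mem_Ioo this
  have hd : ∀ s ∈ Icc a b, HasDerivAt
      (fun s => (∫ r in a..s, (g' r ^ 2 - c ^ 2 * g r ^ 2)) + c * g s ^ 2 * tan (c * (s - m)))
      ((g' s + c * g s * tan (c * (s - m))) ^ 2) s := by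
    intro s hs
    have h2 := integral_hasDerivAt_right (hcont.intervalIntegrable a s)
      hcont.aestronglyMeasurable.stronglyMeasurableAtFilter hcont.continuousAt
    have h3 : HasDerivAt (fun s => c * (s - m)) c s := by
      simpa using ((hasDerivAt_id s).sub_const m).const_mul c
    have h4 := (hasDerivAt_tan (hcos s hs).ne').comp s h3
    refine (h2.add ((((h1 s).pow 2).const_mul c).mul h4)).congr_deriv ?_
    have h5 : 1 / cos (c * (s - m)) ^ 2 = 1 + tan (c * (s - m)) ^ 2 := by
      rw [← inv_one_add_tan_sq (hcos s hs).ne']; simp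
    simp only [Function.comp_apply, Pi.pow_apply, h5]
    push_cast
    ring
  have hmono : MonotoneOn
      (fun s => (∫ r in a..s, (g' r ^ 2 - c ^ 2 * g r ^ 2)) + c * g s ^ 2 * tan (c * (s - m)))
      (Icc a b) := by
    refine monotoneOn_of_deriv_nonneg (convex_Icc a b)
      (fun r hr => (hd r hr).continuousAt.continuousWithinAt)
      (fun r hr => (hd r (interior_subset hr)).differentiableAt.differentiableWithinAt)
      fun r hr => ?_
    rw [(hd r (interior_subset hr)).deriv]
    positivity
  have := hmono (left_mem_Icc.2 hab) (right_mem_Icc.2 hab) hab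
  simp only [integral_same, ga, gb] at this
  have e : ∫ s in a..b, (g' s ^ 2 - c ^ 2 * g s ^ 2) =
      (∫ s in a..b, g' s ^ 2) - c ^ 2 * ∫ s in a..b, g s ^ 2 := by
    rw [integral_sub, integral_const_mul]
    all_goals exact Continuous.intervalIntegrable (by fun_prop) _ _
  rw [e] at this
  linarith

/-- The Dirichlet form of Wirtinger's inequality on an interval of length at most `π`. -/
theorem integral_sq_le_of_zero_endpoints {g g' : ℝ → ℝ} (h1 : ∀ s, HasDerivAt g (g' s) s)
    (hc' : Continuous g') {a b : ℝ} (hab : a ≤ b) (hL : b - a ≤ π) (ga : g a = 0) (gb : g b = 0) :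
    ∫ s in a..b, g s ^ 2 ≤ ∫ s in a..b, g' s ^ 2 := by
  have ht : Tendsto (fun c : ℝ => c ^ 2 * ∫ s in a..b, g s ^ 2) (𝓝[<] 1)
      (𝓝 (1 ^ 2 * ∫ s in a..b, g s ^ 2)) :=
    ((continuous_id.pow 2).mul continuous_const).continuousAt.tendsto.mono_left
      nhdsWithin_le_nhds
  rw [one_pow, one_mul] at ht
  refine le_of_tendsto ht ?_
  filter_upwards [Ioo_mem_nhdsLT (zero_lt_one' ℝ)] with c hc
  exact sq_mul_integral_sq_le h1 hc' hab hL ga gb hc.1 hc.2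

/-- Wirtinger's inequality for mean-zero functions of period at most `2π`. -/
theorem integral_sq_le_of_periodic {f f' : ℝ → ℝ} {l : ℝ} (h1 : ∀ s, HasDerivAt f (f' s) s)
    (hc' : Continuous f') (hp : Function.Periodic f l) (hl : 0 ≤ l) (hl2 : l ≤ 2 * π)
    (hmean : ∫ s in 0..l, f s = 0) : ∫ s in 0..l, f s ^ 2 ≤ ∫ s in 0..l, f' s ^ 2 := by
  have hcf : Continuous f := continuous_iff_continuousAt.2 fun s => (h1 s).continuousAt
  have hp' : Function.Periodic f' l := fun s => by
    have h := (h1 (s + l)).comp_add_const s l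
    rw [funext hp] at h
    exact h.unique (h1 s)
  -- The difference f s - f (s + l / 2) changes sign between 0 and l / 2. The zero a cuts the period
  -- into two intervals of length l / 2 ≤ π on which f - f a vanishes at both ends.
  obtain ⟨a, ha⟩ : ∃ a, f a = f (a + l / 2) := by
    have hcont : Continuous fun s => f s - f (s + l / 2) := by fun_prop
    have e : f l = f 0 := by simpa using hp 0
    have : (0 : ℝ) ∈ range fun s => f s - f (s + l / 2) := by
      rcases le_total (f 0) (f (l / 2)) with h | h
      · exact mem_range_of_exists_le_of_exists_ge hcont ⟨0, by simpa using h⟩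
          ⟨l / 2, by simpa [e] using h⟩
      · exact mem_range_of_exists_le_of_exists_ge hcont ⟨l / 2, by simpa [e] using h⟩
          ⟨0, by simpa using h⟩
    obtain ⟨a, ha⟩ := this
    exact ⟨a, sub_eq_zero.1 ha⟩
  have e1 : f (a + l) = f a := hp a
  have hg : ∀ s, HasDerivAt (fun s => f s - f a) (f' s) s := fun s => (h1 s).sub_const _
  have i1 := integral_sq_le_of_zero_endpoints hg hc' (a := a) (b := a + l / 2)
    (by linarith) (by linarith) (by simp) (by simp [← ha])
  have i2 := integral_sq_le_of_zero_endpoints hg hc' (a := a + l / 2) (b := a + l)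
    (by linarith) (by linarith) (by simp [← ha]) (by simp [e1])
  have hcg : Continuous fun s => (f s - f a) ^ 2 := by fun_prop
  have hcg' : Continuous fun s => f' s ^ 2 := by fun_prop
  have i3 := add_le_add i1 i2
  rw [integral_add_adjacent_intervals (hcg.intervalIntegrable _ _) (hcg.intervalIntegrable _ _),
    integral_add_adjacent_intervals (hcg'.intervalIntegrable _ _) (hcg'.intervalIntegrable _ _)]
    at i3
  have p1 : Function.Periodic (fun s => (f s - f a) ^ 2) l := fun s => by simp only [hp s]
  have p2 : Function.Periodic (fun s => f' s ^ 2) l := fun s => by simp only [hp' s]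
  rw [p1.intervalIntegral_add_eq a 0, p2.intervalIntegral_add_eq a 0, zero_add] at i3
  -- By the mean-zero condition, subtracting the constant f a can only increase the integral of the
  -- square.
  have i4 : ∫ s in 0..l, (f s - f a) ^ 2 = (∫ s in 0..l, f s ^ 2) + l * f a ^ 2 := by
    have : ∀ s, (f s - f a) ^ 2 = (f s ^ 2 - 2 * f a * f s) + f a ^ 2 := fun s => by ring
    simp_rw [this]
    rw [integral_add, integral_sub, integral_const_mul, hmean, integral_const]
    · simp
    all_goals exact Continuous.intervalIntegrable (by fun_prop) _ _
  nlinarith [mul_nonneg hl (sq_nonneg (f a))]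

/-- The integral of the derivative of a periodic function over a period vanishes. -/
theorem integral_deriv_eq_zero_of_periodic {f f' : ℝ → ℝ} {l : ℝ}
    (h1 : ∀ s, HasDerivAt f (f' s) s) (hc' : Continuous f') (hp : Function.Periodic f l) :
    ∫ s in 0..l, f' s = 0 := by
  rw [integral_eq_sub_of_hasDerivAt (fun s _ => h1 s) (hc'.intervalIntegrable _ _)]
  simpa using sub_eq_zero.2 (hp 0)

/-! ### The Lorentz form -/

theorem lorentz_comm (x y : Fin 5 → ℝ) : lorentz x y = lorentz y x := by
  simp only [lorentz]; ring

theorem lorentz_add_left (x y z : Fin 5 → ℝ) :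
    lorentz (x + y) z = lorentz x z + lorentz y z := by
  simp only [lorentz, Pi.add_apply]; ring

theorem lorentz_add_right (x y z : Fin 5 → ℝ) :
    lorentz x (y + z) = lorentz x y + lorentz x z := by
  simp only [lorentz, Pi.add_apply]; ring

theorem lorentz_smul_left (c : ℝ) (x y : Fin 5 → ℝ) :
    lorentz (c • x) y = c * lorentz x y := by
  simp only [lorentz, Pi.smul_apply, smul_eq_mul]; ring

theorem lorentz_smul_right (c : ℝ) (x y : Fin 5 → ℝ) :
    lorentz x (c • y) = c * lorentz x y := by
  simp only [lorentz, Pi.smul_apply, smul_eq_mul]; ring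

theorem _root_.HasDerivAt.lorentz {f g : ℝ → Fin 5 → ℝ} {f' g' : Fin 5 → ℝ} {s : ℝ}
    (hf : HasDerivAt f f' s) (hg : HasDerivAt g g' s) :
    HasDerivAt (fun s => lorentz (f s) (g s)) (lorentz f' (g s) + lorentz (f s) g') s := by
  rw [hasDerivAt_pi] at hf hg
  refine ((((((hf 0).mul (hg 0)).add ((hf 1).mul (hg 1))).add ((hf 2).mul (hg 2))).add
    ((hf 3).mul (hg 3))).sub ((hf 4).mul (hg 4))).congr_deriv ?_
  simp only [DeSitter.lorentz]; ring

theorem _root_.Continuous.lorentz {f g : ℝ → Fin 5 → ℝ} (hf : Continuous f) (hg : Continuous g) :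
    Continuous fun s => lorentz (f s) (g s) := by
  unfold DeSitter.lorentz; fun_prop

theorem lorentz_integral {f : ℝ → Fin 5 → ℝ} (hf : Continuous f) (x : Fin 5 → ℝ) (a b : ℝ) :
    lorentz x (fun i => ∫ s in a..b, f s i) = ∫ s in a..b, lorentz x (f s) := by
  have h : ∀ i, IntervalIntegrable (fun s => x i * f s i) MeasureTheory.volume a b := fun i =>
    Continuous.intervalIntegrable (by fun_prop) _ _
  simp only [lorentz]
  rw [integral_sub ((((h 0).add (h 1)).add (h 2)).add (h 3)) (h 4),
    integral_add (((h 0).add (h 1)).add (h 2)) (h 3), integral_add ((h 0).add (h 1)) (h 2),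
    integral_add (h 0) (h 1)]
  simp only [integral_const_mul]

/-- The Lagrange identity on the orthogonal complement of `N`, up to the factor `N₅²`. -/
theorem sq_mul_lorentz_of_orthogonal {N x : Fin 5 → ℝ} (h : lorentz x N = 0) :
    N 4 ^ 2 * lorentz x x = -lorentz N N * (x 0 ^ 2 + x 1 ^ 2 + x 2 ^ 2 + x 3 ^ 2) +
      ((N 0 * x 1 - N 1 * x 0) ^ 2 + (N 0 * x 2 - N 2 * x 0) ^ 2 + (N 0 * x 3 - N 3 * x 0) ^ 2 +
      (N 1 * x 2 - N 2 * x 1) ^ 2 + (N 1 * x 3 - N 3 * x 1) ^ 2 +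
      (N 2 * x 3 - N 3 * x 2) ^ 2) := by
  have h' : N 4 * x 4 = x 0 * N 0 + x 1 * N 1 + x 2 * N 2 + x 3 * N 3 := by
    simp only [lorentz] at h; linarith
  simp only [lorentz]
  linear_combination (-(N 4 * x 4) - (x 0 * N 0 + x 1 * N 1 + x 2 * N 2 + x 3 * N 3)) * h'

/-- On vectors without time coordinate the form is positive definite. -/
theorem apply_four_ne_zero {x : Fin 5 → ℝ} (hx : x ≠ 0) (h : lorentz x x ≤ 0) : x 4 ≠ 0 := by
  intro h4
  apply hx
  simp only [lorentz, h4] at h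
  have : x 0 ^ 2 + x 1 ^ 2 + x 2 ^ 2 + x 3 ^ 2 ≤ 0 := by linarith
  have h0 : x 0 = 0 := by
    nlinarith [sq_nonneg (x 0), sq_nonneg (x 1), sq_nonneg (x 2),
      sq_nonneg (x 3)]
  have h1 : x 1 = 0 := by
    nlinarith [sq_nonneg (x 0), sq_nonneg (x 1), sq_nonneg (x 2),
      sq_nonneg (x 3)]
  have h2 : x 2 = 0 := by
    nlinarith [sq_nonneg (x 0), sq_nonneg (x 1), sq_nonneg (x 2),
      sq_nonneg (x 3)]
  have h3 : x 3 = 0 := by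
    nlinarith [sq_nonneg (x 0), sq_nonneg (x 1), sq_nonneg (x 2),
      sq_nonneg (x 3)]
  ext i; fin_cases i <;> simp [h0, h1, h2, h3, h4]

/-- A causal vector orthogonal to the causal vector `N`, where `N₅ ≠ 0`, is a multiple of `N`. -/
theorem eq_smul_of_orthogonal {N x : Fin 5 → ℝ} (hN : lorentz N N ≤ 0) (hN4 : N 4 ≠ 0)
    (hx : lorentz x x ≤ 0) (h : lorentz x N = 0) :
    x = (x 4 / N 4) • N := by
  set c := x 4 / N 4 with hc
  have hc4 : x 4 = c * N 4 := by rw [hc]; field_simp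
  -- The scalar c cancels the time coordinate, and x - c • N is still causal, so it must be zero.
  have hz : lorentz (x - c • N) (x - c • N) ≤ 0 := by
    have : lorentz (x - c • N) (x - c • N) =
        lorentz x x - 2 * c * lorentz x N + c ^ 2 * lorentz N N := by
      simp only [lorentz, Pi.sub_apply, Pi.smul_apply, smul_eq_mul]; ring
    rw [this, h]
    nlinarith [sq_nonneg c]
  by_contra hne
  exact apply_four_ne_zero (sub_ne_zero.2 hne) hz (by simp [hc4])

/-- Causal vectors in the same time cone have non-positive Lorentz product. -/
theorem lorentz_nonpos {x y : Fin 5 → ℝ} (hx : lorentz x x ≤ 0) (hy : lorentz y y ≤ 0)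
    (h : 0 < x 4 * y 4) : lorentz x y ≤ 0 := by
  simp only [lorentz] at *
  have key : (x 0 * y 0 + x 1 * y 1 + x 2 * y 2 + x 3 * y 3) ^ 2 ≤ (x 4 * y 4) ^ 2 := by
    have l : (x 0 * y 0 + x 1 * y 1 + x 2 * y 2 + x 3 * y 3) ^ 2 ≤
        (x 0 ^ 2 + x 1 ^ 2 + x 2 ^ 2 + x 3 ^ 2) * (y 0 ^ 2 + y 1 ^ 2 + y 2 ^ 2 + y 3 ^ 2) := by
      linarith [sq_nonneg (x 0 * y 1 - x 1 * y 0), sq_nonneg (x 0 * y 2 - x 2 * y 0),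
        sq_nonneg (x 0 * y 3 - x 3 * y 0), sq_nonneg (x 1 * y 2 - x 2 * y 1),
        sq_nonneg (x 1 * y 3 - x 3 * y 1), sq_nonneg (x 2 * y 3 - x 3 * y 2)]
    have m : (x 0 ^ 2 + x 1 ^ 2 + x 2 ^ 2 + x 3 ^ 2) * (y 0 ^ 2 + y 1 ^ 2 + y 2 ^ 2 + y 3 ^ 2) ≤
        x 4 ^ 2 * y 4 ^ 2 :=
      mul_le_mul (by linarith) (by linarith) (by positivity) (by positivity)
    linarith
  have := abs_le_of_sq_le_sq' key h.le
  linarith [this.2]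

/-! ### Closed curves in arc-length parameter -/

/-- A closed curve `γ` of length `l` in de Sitter space, in its arc-length parameter, with first
and second derivatives `γ'` and `γ''` and with nowhere space-like, nowhere vanishing geodesic
curvature vector `K`. -/
structure IsUnitSpeedCurve (l : ℝ) (γ γ' γ'' K : ℝ → Fin 5 → ℝ) : Prop where
  pos : 0 < l
  hasDerivAt : ∀ s, HasDerivAt γ (γ' s) s
  hasDerivAt' : ∀ s, HasDerivAt γ' (γ'' s) s
  continuous'' : Continuous γ''
  periodic : Function.Periodic γ l
  unit : ∀ s, lorentz (γ s) (γ s) = 1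
  unit' : ∀ s, lorentz (γ' s) (γ' s) = 1
  curvature : ∀ s, K s = γ s + γ'' s
  ne_zero : ∀ s, K s ≠ 0
  causal : ∀ s, lorentz (K s) (K s) ≤ 0

namespace IsUnitSpeedCurve

variable {l : ℝ} {γ γ' γ'' K : ℝ → Fin 5 → ℝ}

theorem continuous (h : IsUnitSpeedCurve l γ γ' γ'' K) : Continuous γ :=
  continuous_iff_continuousAt.2 fun s => (h.hasDerivAt s).continuousAt

theorem continuous' (h : IsUnitSpeedCurve l γ γ' γ'' K) : Continuous γ' :=
  continuous_iff_continuousAt.2 fun s => (h.hasDerivAt' s).continuousAt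

theorem continuous_curvature (h : IsUnitSpeedCurve l γ γ' γ'' K) : Continuous K := by
  rw [funext h.curvature]
  exact h.continuous.add h.continuous''

theorem periodic' (h : IsUnitSpeedCurve l γ γ' γ'' K) : Function.Periodic γ' l := fun s => by
  have h' := (h.hasDerivAt (s + l)).comp_add_const s l
  rw [funext h.periodic] at h'
  exact h'.unique (h.hasDerivAt s)

theorem lorentz_velocity (h : IsUnitSpeedCurve l γ γ' γ'' K) (s : ℝ) :
    lorentz (γ s) (γ' s) = 0 := by
  have h1 := (h.hasDerivAt s).lorentz (h.hasDerivAt s)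
  rw [funext h.unit] at h1
  have := h1.unique (hasDerivAt_const s (1 : ℝ))
  rw [lorentz_comm (γ' s)] at this
  linarith

theorem lorentz_acceleration (h : IsUnitSpeedCurve l γ γ' γ'' K) (s : ℝ) :
    lorentz (γ s) (γ'' s) = -1 := by
  have h1 := (h.hasDerivAt s).lorentz (h.hasDerivAt' s)
  rw [funext h.lorentz_velocity] at h1
  have := h1.unique (hasDerivAt_const s (0 : ℝ))
  linarith [h.unit' s]

theorem lorentz_velocity_acceleration (h : IsUnitSpeedCurve l γ γ' γ'' K) (s : ℝ) :
    lorentz (γ' s) (γ'' s) = 0 := by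
  have h1 := (h.hasDerivAt' s).lorentz (h.hasDerivAt' s)
  rw [funext h.unit'] at h1
  have := h1.unique (hasDerivAt_const s (1 : ℝ))
  rw [lorentz_comm (γ'' s)] at this
  linarith

/-- With `lorentz_velocity_curvature`, this gives s ↦ ⟨γ s, K r⟩ the double zero at s = r from which
the Sturm comparison starts. -/
theorem lorentz_curvature (h : IsUnitSpeedCurve l γ γ' γ'' K) (s : ℝ) :
    lorentz (γ s) (K s) = 0 := by
  rw [h.curvature, lorentz_add_right, h.unit, h.lorentz_acceleration]; norm_num

theorem lorentz_velocity_curvature (h : IsUnitSpeedCurve l γ γ' γ'' K) (s : ℝ) :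
    lorentz (γ' s) (K s) = 0 := by
  rw [h.curvature, lorentz_add_right, h.lorentz_velocity_acceleration, lorentz_comm,
    h.lorentz_velocity]; norm_num

/-- The product with a fixed vector, and its first two derivatives. -/
theorem hasDerivAt_lorentz (h : IsUnitSpeedCurve l γ γ' γ'' K) (x : Fin 5 → ℝ) (s : ℝ) :
    HasDerivAt (fun s => lorentz (γ s) x) (lorentz (γ' s) x) s :=
  ((h.hasDerivAt s).lorentz (hasDerivAt_const s x)).congr_deriv (by simp [lorentz])

theorem hasDerivAt_lorentz' (h : IsUnitSpeedCurve l γ γ' γ'' K) (x : Fin 5 → ℝ) (s : ℝ) :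
    HasDerivAt (fun s => lorentz (γ' s) x) (lorentz (γ'' s) x) s :=
  ((h.hasDerivAt' s).lorentz (hasDerivAt_const s x)).congr_deriv (by simp [lorentz])

/-- The geodesic curvature vectors all lie in the same half of the light cone. -/
theorem apply_four_mul_pos (h : IsUnitSpeedCurve l γ γ' γ'' K) (s r : ℝ) :
    0 < K s 4 * K r 4 := by
  have h0 : ∀ s, K s 4 ≠ 0 := fun s => apply_four_ne_zero (h.ne_zero s) (h.causal s)
  have hc : Continuous fun s => K s 4 := (continuous_apply 4).comp h.continuous_curvature
  rcases lt_or_gt_of_ne (h0 s) with hs | hs <;> rcases lt_or_gt_of_ne (h0 r) with hr | hr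
  · exact mul_pos_of_neg_of_neg hs hr
  · obtain ⟨a, ha⟩ := mem_range_of_exists_le_of_exists_ge hc ⟨s, hs.le⟩ ⟨r, hr.le⟩
    exact absurd ha (h0 a)
  · obtain ⟨a, ha⟩ := mem_range_of_exists_le_of_exists_ge hc ⟨r, hr.le⟩ ⟨s, hs.le⟩
    exact absurd ha (h0 a)
  · exact mul_pos hs hr

theorem lorentz_curvature_nonpos (h : IsUnitSpeedCurve l γ γ' γ'' K) (s r : ℝ) :
    lorentz (K s) (K r) ≤ 0 :=
  lorentz_nonpos (h.causal s) (h.causal r) (h.apply_four_mul_pos s r)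

/-- If the length is at most `2π`, the whole curve is on one side of the hyperplane orthogonal to
any of its geodesic curvature vectors. -/
theorem lorentz_curve_curvature_nonpos (h : IsUnitSpeedCurve l γ γ' γ'' K) (hl : l ≤ 2 * π)
    (s r : ℝ) : lorentz (γ s) (K r) ≤ 0 := by
  -- Moving s by periods puts it within l / 2 ≤ π of r, the range of the Sturm comparison.
  obtain ⟨s', hs', e⟩ := h.periodic.exists_mem_Ico h.pos s (r - l / 2)
  rw [e]
  have := nonneg_of_deriv2_add_nonneg (f := fun s => -lorentz (γ s) (K r))
    (fun s => (h.hasDerivAt_lorentz (K r) s).neg) (fun s => (h.hasDerivAt_lorentz' (K r) s).neg)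
    (fun s => by
      have h1 := h.lorentz_curvature_nonpos s r
      rw [h.curvature s, lorentz_add_left] at h1
      linarith) (a := r) (s := s')
    (by simp [h.lorentz_curvature]) (by simp [h.lorentz_velocity_curvature])
    (by rw [abs_le]; constructor <;> linarith [hs'.1, hs'.2])
  linarith

/-! ### The total geodesic curvature vector -/

/-- The velocity is periodic, so γ'' integrates to zero; the total curvature vector is thus also the
integral of the position. -/
theorem integral_curvature_apply (h : IsUnitSpeedCurve l γ γ' γ'' K) (i : Fin 5) :
    ∫ s in 0..l, K s i = ∫ s in 0..l, γ s i := by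
  have h1 := integral_deriv_eq_zero_of_periodic (l := l)
    (fun s => hasDerivAt_pi.1 (h.hasDerivAt' s) i)
    ((continuous_apply i).comp h.continuous'') fun s => by simp only [h.periodic' s]
  have hc := h.continuous
  have hc'' := h.continuous''
  simp only [h.curvature, Pi.add_apply]
  rw [integral_add, h1, add_zero]
  all_goals exact Continuous.intervalIntegrable (by fun_prop) _ _

/-- The total geodesic curvature vector. -/
noncomputable def total (l : ℝ) (K : ℝ → Fin 5 → ℝ) : Fin 5 → ℝ := fun i => ∫ s in 0..l, K s i

theorem lorentz_total (h : IsUnitSpeedCurve l γ γ' γ'' K) (x : Fin 5 → ℝ) :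
    lorentz x (total l K) = ∫ s in 0..l, lorentz x (K s) :=
  lorentz_integral h.continuous_curvature x 0 l

theorem lorentz_curvature_total_nonpos (h : IsUnitSpeedCurve l γ γ' γ'' K) (s : ℝ) :
    lorentz (K s) (total l K) ≤ 0 := by
  rw [h.lorentz_total, ← neg_nonneg, ← integral_neg]
  exact integral_nonneg h.pos.le fun r _ => neg_nonneg.2 (h.lorentz_curvature_nonpos s r)

theorem lorentz_total_total (h : IsUnitSpeedCurve l γ γ' γ'' K) :
    lorentz (total l K) (total l K) = ∫ s in 0..l, lorentz (K s) (total l K) := by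
  rw [h.lorentz_total]
  simp only [lorentz_comm]

theorem lorentz_total_total_nonpos (h : IsUnitSpeedCurve l γ γ' γ'' K) :
    lorentz (total l K) (total l K) ≤ 0 := by
  rw [h.lorentz_total_total, ← neg_nonneg, ← integral_neg]
  exact integral_nonneg h.pos.le fun r _ => neg_nonneg.2 (h.lorentz_curvature_total_nonpos r)

/-- The time coordinates of K share one sign and cannot cancel; the factor K 0 4 normalizes that
sign. -/
theorem total_apply_four_ne_zero (h : IsUnitSpeedCurve l γ γ' γ'' K) : total l K 4 ≠ 0 := by
  have hc : Continuous fun s => K s 4 := (continuous_apply 4).comp h.continuous_curvature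
  have : 0 < ∫ s in 0..l, K 0 4 * K s 4 :=
    intervalIntegral_pos_of_pos ((hc.const_mul _).intervalIntegrable _ _)
      (h.apply_four_mul_pos 0) h.pos
  rw [integral_const_mul] at this
  exact right_ne_zero_of_mul this.ne'

/-- A continuous non-positive function with zero integral vanishes. -/
theorem eq_zero_of_integral_eq_zero {f : ℝ → ℝ} {l : ℝ} (hl : 0 < l) (hc : Continuous f)
    (hf : ∀ s, f s ≤ 0) (hp : Function.Periodic f l) (h0 : 0 ≤ ∫ s in 0..l, f s) (s : ℝ) :
    f s = 0 := by
  by_contra hs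
  obtain ⟨r, hr, e⟩ := hp.exists_mem_Ico₀ hl s
  have h1 : 0 < ∫ s in 0..l, -f s :=
    integral_pos hl hc.neg.continuousOn (fun s _ => neg_nonneg.2 (hf s))
      ⟨r, Ico_subset_Icc_self hr, neg_pos.2 (lt_of_le_of_ne (hf r) (e ▸ hs))⟩
  rw [integral_neg] at h1
  linarith

theorem periodic_curvature (h : IsUnitSpeedCurve l γ γ' γ'' K) : Function.Periodic K l :=
    fun s => by
  have h' := (h.hasDerivAt' (s + l)).comp_add_const s l
  rw [funext h.periodic'] at h'
  rw [h.curvature, h.curvature, h.periodic s, h'.unique (h.hasDerivAt' s)]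

/-- If the total geodesic curvature vector is null, then the geodesic curvature vectors are all
proportional to it. -/
theorem lorentz_curvature_total_eq_zero (h : IsUnitSpeedCurve l γ γ' γ'' K)
    (hN : lorentz (total l K) (total l K) = 0) (s : ℝ) : lorentz (K s) (total l K) = 0 :=
  eq_zero_of_integral_eq_zero h.pos (h.continuous_curvature.lorentz continuous_const)
    h.lorentz_curvature_total_nonpos (fun s => by simp only [h.periodic_curvature s])
    (by rw [← h.lorentz_total_total, hN]) s

/-- Wirtinger's inequality for the part of the curve orthogonal to its total curvature vector,
written in terms of the product with that vector. -/
theorem integral_sq_lorentz_total_le (h : IsUnitSpeedCurve l γ γ' γ'' K) (hl : l ≤ 2 * π)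
    (hN : lorentz (total l K) (total l K) < 0) :
    ∫ s in 0..l, lorentz (γ s) (total l K) ^ 2 ≤ ∫ s in 0..l, lorentz (γ' s) (total l K) ^ 2 := by
  set N := total l K with hNdef
  set q := -lorentz N N with hq
  have hq0 : 0 < q := by linarith
  -- This is q times the projection of γ to the complement of N; the scaling avoids a division.
  set y : ℝ → Fin 5 → ℝ := fun s => q • γ s + lorentz (γ s) N • N with hy
  set y' : ℝ → Fin 5 → ℝ := fun s => q • γ' s + lorentz (γ' s) N • N with hy'
  have dy : ∀ i s, HasDerivAt (fun s => y s i) (y' s i) s := fun i s =>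
    ((hasDerivAt_pi.1 (h.hasDerivAt s) i).const_mul q).add
      ((h.hasDerivAt_lorentz N s).mul_const (N i))
  have hg := h.continuous
  have hg' := h.continuous'
  have c1 := hg.lorentz (continuous_const (y := N))
  have c1' := hg'.lorentz (continuous_const (y := N))
  have cy' : Continuous y' := by fun_prop
  have cy : Continuous y := by fun_prop
  have py : Function.Periodic y l := fun s => by simp only [hy, h.periodic s]
  -- Because N = ∫ γ, the integral of y is q N + ⟨N, N⟩ N = 0.
  have my : ∀ i, ∫ s in 0..l, y s i = 0 := by
    intro i
    have e1 : ∫ s in 0..l, lorentz (γ s) N = lorentz N N := by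
      have : N = total l γ := funext fun i => h.integral_curvature_apply i
      calc _ = ∫ s in 0..l, lorentz N (γ s) := by simp only [lorentz_comm]
        _ = lorentz N (total l γ) := (lorentz_integral hg N 0 l).symm
        _ = _ := by rw [← this]
    have e2 : ∫ s in 0..l, γ s i = N i := (h.integral_curvature_apply i).symm
    simp only [hy, Pi.add_apply, Pi.smul_apply, smul_eq_mul]
    rw [integral_add, integral_const_mul, integral_mul_const, e1, e2, hq]
    · ring
    all_goals exact Continuous.intervalIntegrable (by fun_prop) _ _
  have w1 : ∀ i, ∫ s in 0..l, y s i ^ 2 ≤ ∫ s in 0..l, y' s i ^ 2 := fun i =>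
    integral_sq_le_of_periodic (dy i) (by fun_prop) (fun s => by simp only [py s]) h.pos.le hl
      (my i)
  have w2 : ∀ i j, ∫ s in 0..l, (N i * y s j - N j * y s i) ^ 2 ≤
      ∫ s in 0..l, (N i * y' s j - N j * y' s i) ^ 2 := fun i j => by
    refine integral_sq_le_of_periodic
      (fun s => ((dy j s).const_mul (N i)).sub ((dy i s).const_mul (N j))) (by fun_prop)
      (fun s => by simp only [py s]) h.pos.le hl ?_
    rw [integral_sub, integral_const_mul, integral_const_mul, my, my]
    · simp
    all_goals exact Continuous.intervalIntegrable (by fun_prop) _ _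
  -- On the complement of N the form is, up to the factor N 4 ^ 2, a nonnegative combination of
  -- squares of linear functions, so the scalar Wirtinger inequality applies termwise without an
  -- orthonormal basis.
  have split : ∀ z : ℝ → Fin 5 → ℝ, Continuous z → (∀ s, lorentz (z s) N = 0) →
      N 4 ^ 2 * ∫ s in 0..l, lorentz (z s) (z s) =
      q * ((∫ s in 0..l, z s 0 ^ 2) + (∫ s in 0..l, z s 1 ^ 2) + (∫ s in 0..l, z s 2 ^ 2) +
        ∫ s in 0..l, z s 3 ^ 2) +
      ((∫ s in 0..l, (N 0 * z s 1 - N 1 * z s 0) ^ 2) +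
        (∫ s in 0..l, (N 0 * z s 2 - N 2 * z s 0) ^ 2) +
        (∫ s in 0..l, (N 0 * z s 3 - N 3 * z s 0) ^ 2) +
        (∫ s in 0..l, (N 1 * z s 2 - N 2 * z s 1) ^ 2) +
        (∫ s in 0..l, (N 1 * z s 3 - N 3 * z s 1) ^ 2) +
        ∫ s in 0..l, (N 2 * z s 3 - N 3 * z s 2) ^ 2) := by
    intro z hz hzN
    rw [← integral_const_mul]
    simp_rw [sq_mul_lorentz_of_orthogonal (hzN _)]
    have a1 : ∀ i, IntervalIntegrable (fun s => z s i ^ 2) MeasureTheory.volume 0 l := fun i =>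
      Continuous.intervalIntegrable (by fun_prop) _ _
    have a2 : ∀ i j, IntervalIntegrable (fun s => (N i * z s j - N j * z s i) ^ 2)
        MeasureTheory.volume 0 l := fun i j => Continuous.intervalIntegrable (by fun_prop) _ _
    rw [integral_add (Continuous.intervalIntegrable (by fun_prop) _ _)
      (Continuous.intervalIntegrable (by fun_prop) _ _), integral_const_mul,
      integral_add (((a1 0).add (a1 1)).add (a1 2)) (a1 3),
      integral_add ((a1 0).add (a1 1)) (a1 2), integral_add (a1 0) (a1 1),
      integral_add (((((a2 0 1).add (a2 0 2)).add (a2 0 3)).add (a2 1 2)).add (a2 1 3)) (a2 2 3),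
      integral_add ((((a2 0 1).add (a2 0 2)).add (a2 0 3)).add (a2 1 2)) (a2 1 3),
      integral_add (((a2 0 1).add (a2 0 2)).add (a2 0 3)) (a2 1 2),
      integral_add ((a2 0 1).add (a2 0 2)) (a2 0 3), integral_add (a2 0 1) (a2 0 2)]
  have proj : ∀ x : Fin 5 → ℝ, lorentz (q • x + lorentz x N • N) N = 0 := fun x => by
    rw [lorentz_add_left, lorentz_smul_left, lorentz_smul_left, hq]; ring
  -- Both γ and γ' have unit norm, so the same q ^ 2 appears on the two sides and cancels.
  have norm : ∀ x : Fin 5 → ℝ, lorentz x x = 1 →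
      lorentz (q • x + lorentz x N • N) (q • x + lorentz x N • N) =
        q ^ 2 + q * lorentz x N ^ 2 := fun x hx => by
    rw [lorentz_add_right, lorentz_smul_right, lorentz_smul_right, proj, lorentz_add_left,
      lorentz_smul_left, lorentz_smul_left, hx, lorentz_comm N x]
    ring
  have s1 := split y cy fun s => proj _
  have s2 := split y' cy' fun s => proj _
  have key : N 4 ^ 2 * ∫ s in 0..l, lorentz (y s) (y s) ≤
      N 4 ^ 2 * ∫ s in 0..l, lorentz (y' s) (y' s) := by
    rw [s1, s2]
    gcongr
    all_goals first | exact w1 _ | exact w2 _ _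
  have key2 := le_of_mul_le_mul_left key (by have := h.total_apply_four_ne_zero; positivity)
  have n1 : ∀ s, lorentz (y s) (y s) = q ^ 2 + q * lorentz (γ s) N ^ 2 := fun s =>
    norm _ (h.unit s)
  have n2 : ∀ s, lorentz (y' s) (y' s) = q ^ 2 + q * lorentz (γ' s) N ^ 2 := fun s =>
    norm _ (h.unit' s)
  simp_rw [n1, n2] at key2
  rw [integral_add (Continuous.intervalIntegrable (by fun_prop) _ _)
      (Continuous.intervalIntegrable (by fun_prop) _ _),
    integral_add (Continuous.intervalIntegrable (by fun_prop) _ _)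
      (Continuous.intervalIntegrable (by fun_prop) _ _), integral_const_mul,
    integral_const_mul] at key2
  exact le_of_mul_le_mul_left (by linarith) hq0

/-- If the total geodesic curvature vector is time-like, the curve is longer than `2π`. -/
theorem two_pi_lt_of_total_timelike (h : IsUnitSpeedCurve l γ γ' γ'' K)
    (hN : lorentz (total l K) (total l K) < 0) : 2 * π < l := by
  by_contra! hl
  have w := h.integral_sq_lorentz_total_le hl hN
  set N := total l K with hNdef
  have c1 := h.continuous.lorentz (continuous_const (y := N))
  have c2 := h.continuous'.lorentz (continuous_const (y := N))
  have c3 := h.continuous''.lorentz (continuous_const (y := N))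
  have cK := h.continuous_curvature.lorentz (continuous_const (y := N))
  have hneg : ∀ s, lorentz (γ s) N ≤ 0 := fun s => by
    rw [hNdef, h.lorentz_total, ← neg_nonneg, ← integral_neg]
    exact integral_nonneg h.pos.le fun r _ =>
      neg_nonneg.2 (h.lorentz_curve_curvature_nonpos hl s r)
  have parts : ∫ s in 0..l, (lorentz (γ' s) N * lorentz (γ' s) N +
      lorentz (γ s) N * lorentz (γ'' s) N) = 0 :=
    integral_deriv_eq_zero_of_periodic
      (fun s => (h.hasDerivAt_lorentz N s).mul (h.hasDerivAt_lorentz' N s)) (by fun_prop)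
      fun s => by simp only [Pi.mul_apply, h.periodic s, h.periodic' s]
  have e : ∫ s in 0..l, lorentz (γ s) N * lorentz (K s) N =
      (∫ s in 0..l, lorentz (γ s) N ^ 2) - ∫ s in 0..l, lorentz (γ' s) N ^ 2 := by
    have : ∀ s, lorentz (γ s) N * lorentz (K s) N =
        (lorentz (γ s) N ^ 2 - lorentz (γ' s) N ^ 2) + (lorentz (γ' s) N * lorentz (γ' s) N +
          lorentz (γ s) N * lorentz (γ'' s) N) := fun s => by
      rw [h.curvature, lorentz_add_left]; ring
    simp_rw [this]
    rw [integral_add (Continuous.intervalIntegrable (by fun_prop) _ _)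
      (Continuous.intervalIntegrable (by fun_prop) _ _), parts, add_zero,
      integral_sub (Continuous.intervalIntegrable (by fun_prop) _ _)
      (Continuous.intervalIntegrable (by fun_prop) _ _)]
  -- A causal vector orthogonal to the time-like N is a multiple of N, hence zero.
  have hKN : ∀ s, lorentz (K s) N ≠ 0 := fun s hs => by
    have e1 := eq_smul_of_orthogonal hN.le h.total_apply_four_ne_zero (h.causal s) hs
    rw [e1, lorentz_smul_left] at hs
    rcases mul_eq_zero.1 hs with h0 | h0
    · exact h.ne_zero s (by rw [e1, h0, zero_smul])
    · exact hN.ne h0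
  -- The product ⟨γ, N⟩⟨K, N⟩ is nonnegative, while `e` and Wirtinger's inequality `w` make its
  -- integral nonpositive.
  have z : ∀ s, lorentz (γ s) N = 0 := by
    intro s
    have := eq_zero_of_integral_eq_zero h.pos
      (f := fun s => -(lorentz (γ s) N * lorentz (K s) N)) (by fun_prop)
      (fun s => neg_nonpos.2 (mul_nonneg_of_nonpos_of_nonpos (hneg s)
        (h.lorentz_curvature_total_nonpos s)))
      (fun s => by simp only [h.periodic s, h.periodic_curvature s])
      (by rw [integral_neg, e]; linarith) s
    exact (mul_eq_zero.1 (neg_eq_zero.1 this)).resolve_right (hKN s)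
  have z' : ∀ s, lorentz (γ' s) N = 0 := fun s => by
    have := h.hasDerivAt_lorentz N s
    rw [funext z] at this
    exact this.unique (hasDerivAt_const s (0 : ℝ))
  have z'' : lorentz (γ'' 0) N = 0 := by
    have := h.hasDerivAt_lorentz' N 0
    rw [funext z'] at this
    exact this.unique (hasDerivAt_const 0 (0 : ℝ))
  exact hKN 0 (by rw [h.curvature, lorentz_add_left, z, z'', add_zero])

/-- A closed curve whose total geodesic curvature vector is null has constant light-like
curvature line. -/
theorem eq_smul_total (h : IsUnitSpeedCurve l γ γ' γ'' K)
    (hN : lorentz (total l K) (total l K) = 0) (s : ℝ) :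
    K s = (K s 4 / total l K 4) • total l K :=
  eq_smul_of_orthogonal hN.le h.total_apply_four_ne_zero (h.causal s)
    (h.lorentz_curvature_total_eq_zero hN s)

/-- A curve whose curvature vectors are all proportional to a fixed null vector `u` is a sum of a
unit circle and of a multiple of `u`. -/
theorem eq_drill (h : IsUnitSpeedCurve l γ γ' γ'' K) {u : Fin 5 → ℝ} (hu : u 4 ≠ 0)
    (hK : ∀ s, ∃ c : ℝ, K s = c • u) (s : ℝ) :
    γ s = ((γ s 4 - cos s * γ 0 4 - sin s * γ' 0 4) / u 4) • u + cos s • γ 0 + sin s • γ' 0 := by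
  -- The difference δ between γ and the circle with the same initial data satisfies δ'' + δ = K, a
  -- multiple of u. So the minors of δ against u solve f'' + f = 0 with zero initial data.
  have key : ∀ i, u 4 * (γ s i - cos s * γ 0 i - sin s * γ' 0 i) -
      u i * (γ s 4 - cos s * γ 0 4 - sin s * γ' 0 4) = 0 := by
    intro i
    have d1 : ∀ i s, HasDerivAt (fun s => γ s i - cos s * γ 0 i - sin s * γ' 0 i)
        (γ' s i + sin s * γ 0 i - cos s * γ' 0 i) s := fun i s =>
      (((hasDerivAt_pi.1 (h.hasDerivAt s) i).sub ((hasDerivAt_cos s).mul_const _)).sub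
        ((hasDerivAt_sin s).mul_const _)).congr_deriv (by ring)
    have d2 : ∀ i s, HasDerivAt (fun s => γ' s i + sin s * γ 0 i - cos s * γ' 0 i)
        (γ'' s i + cos s * γ 0 i + sin s * γ' 0 i) s := fun i s =>
      (((hasDerivAt_pi.1 (h.hasDerivAt' s) i).add ((hasDerivAt_sin s).mul_const _)).sub
        ((hasDerivAt_cos s).mul_const _)).congr_deriv (by ring)
    refine eq_zero_of_deriv2_add_eq_zero (a := 0)
      (f := fun s => u 4 * (γ s i - cos s * γ 0 i - sin s * γ' 0 i) -
      u i * (γ s 4 - cos s * γ 0 4 - sin s * γ' 0 4))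
      (fun s => ((d1 i s).const_mul (u 4)).sub ((d1 4 s).const_mul (u i)))
      (fun s => ((d2 i s).const_mul (u 4)).sub ((d2 4 s).const_mul (u i))) (fun s => ?_)
      (by simp) (by simp) s
    obtain ⟨c, hc⟩ := hK s
    rw [h.curvature] at hc
    have hi := congrFun hc i
    have h4 := congrFun hc 4
    simp only [Pi.add_apply, Pi.smul_apply, smul_eq_mul] at hi h4
    linear_combination u 4 * hi - u i * h4
  ext i
  simp only [Pi.add_apply, Pi.smul_apply, smul_eq_mul]
  field_simp
  linear_combination key i

end IsUnitSpeedCurve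

/-! ### Circles plus multiples of a null vector -/

/-- The curve is `lam(s) u + cos s v + sin s w` with `u` light-like and `v`, `w` orthonormal. -/
def IsDrill (l : ℝ) (γ : ℝ → Fin 5 → ℝ) (lam : ℝ → ℝ) (u v w : Fin 5 → ℝ) : Prop :=
  ContDiff ℝ 2 lam ∧ Function.Periodic lam l ∧
    IsLightlike u ∧ lorentz v v = 1 ∧ lorentz w w = 1 ∧
    lorentz u v = 0 ∧ lorentz u w = 0 ∧ lorentz v w = 0 ∧
    ∀ s, γ s = lam s • u + cos s • v + sin s • w

theorem contDiff_two_of_hasDerivAt {f f' f'' : ℝ → ℝ} (h1 : ∀ s, HasDerivAt f (f' s) s)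
    (h2 : ∀ s, HasDerivAt f' (f'' s) s) (hc : Continuous f'') : ContDiff ℝ 2 f := by
  have e1 : deriv f = f' := funext fun s => (h1 s).deriv
  have e2 : deriv f' = f'' := funext fun s => (h2 s).deriv
  rw [show (2 : WithTop ℕ∞) = 1 + 1 from rfl, contDiff_succ_iff_deriv]
  refine ⟨fun s => (h1 s).differentiableAt, by simp, ?_⟩
  rw [e1, contDiff_one_iff_deriv, e2]
  exact ⟨fun s => (h2 s).differentiableAt, hc⟩

/-- Pairing with v, and likewise with w, sees only the circle: a point of the curve determines its
arc-length parameter modulo 2π. -/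
theorem IsDrill.lorentz_left {l : ℝ} {γ : ℝ → Fin 5 → ℝ} {lam : ℝ → ℝ} {u v w : Fin 5 → ℝ}
    (h : IsDrill l γ lam u v w) (s : ℝ) : lorentz (γ s) v = cos s := by
  obtain ⟨-, -, -, vv, -, uv, -, vw, e⟩ := h
  simp only [e, lorentz_add_left, lorentz_smul_left, vv, uv, lorentz_comm w v, vw]; ring

theorem IsDrill.lorentz_right {l : ℝ} {γ : ℝ → Fin 5 → ℝ} {lam : ℝ → ℝ} {u v w : Fin 5 → ℝ}
    (h : IsDrill l γ lam u v w) (s : ℝ) : lorentz (γ s) w = sin s := by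
  obtain ⟨-, -, -, -, ww, -, uw, vw, e⟩ := h
  simp only [e, lorentz_add_left, lorentz_smul_left, ww, uw, vw]; ring

theorem IsDrill.injOn {l : ℝ} {γ : ℝ → Fin 5 → ℝ} {lam : ℝ → ℝ} {u v w : Fin 5 → ℝ}
    (h : IsDrill l γ lam u v w) : InjOn γ (Ico 0 (2 * π)) := by
  intro s hs r hr e
  have e1 : cos s = cos r := by rw [← h.lorentz_left, e, h.lorentz_left]
  have e2 : sin s = sin r := by rw [← h.lorentz_right, e, h.lorentz_right]
  have : cos (s - r) = 1 := by
    rw [cos_sub, e1, e2]; linarith [sin_sq_add_cos_sq r]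
  rw [cos_eq_one_iff_of_lt_of_lt (by linarith [hs.1, hr.2]) (by linarith [hs.2, hr.1])] at this
  linarith

/-- A periodic continuous function takes the same value at two points at any given distance. -/
theorem exists_apply_add_eq {f : ℝ → ℝ} {l : ℝ} (hl : 0 < l) (hc : Continuous f)
    (hp : Function.Periodic f l) (d : ℝ) : ∃ s ∈ Ico 0 l, f (s + d) = f s := by
  obtain ⟨m, -, hm⟩ := isCompact_Icc.exists_isMaxOn (nonempty_Icc.2 hl.le) hc.continuousOn
  have hmax : ∀ s, f s ≤ f m := fun s => by
    obtain ⟨r, hr, e⟩ := hp.exists_mem_Ico₀ hl s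
    rw [e]
    exact hm (Ico_subset_Icc_self hr)
  have hcd : Continuous fun s => f (s + d) - f s := by fun_prop
  -- At a maximum point m the increment over d is ≤ 0, and at m - d it is ≥ 0.
  obtain ⟨a, ha⟩ := mem_range_of_exists_le_of_exists_ge hcd (c := 0)
    ⟨m, sub_nonpos.2 (hmax _)⟩ ⟨m - d, by simpa using hmax (m - d)⟩
  have hpd : Function.Periodic (fun s => f (s + d) - f s) l := fun s => by
    simp only [hp s, add_right_comm s l d, hp (s + d)]
  obtain ⟨r, hr, e⟩ := hpd.exists_mem_Ico₀ hl a
  exact ⟨r, hr, sub_eq_zero.1 (e.symm.trans ha)⟩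

namespace IsUnitSpeedCurve

variable {l : ℝ} {γ γ' γ'' K : ℝ → Fin 5 → ℝ}

theorem isDrill (h : IsUnitSpeedCurve l γ γ' γ'' K) {u : Fin 5 → ℝ} (hu : IsLightlike u)
    (hK : ∀ s, ∃ c : ℝ, K s = c • u) :
    IsDrill l γ (fun s => (γ s 4 - cos s * γ 0 4 - sin s * γ' 0 4) / u 4) u (γ 0) (γ' 0) := by
  have hu4 := apply_four_ne_zero hu.1 hu.2.le
  obtain ⟨c, hc⟩ := hK 0
  have hc0 : c ≠ 0 := fun h0 => h.ne_zero 0 (by rw [hc, h0, zero_smul])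
  have uv : lorentz u (γ 0) = 0 := by
    have := h.lorentz_curvature 0
    rw [hc, lorentz_smul_right, lorentz_comm] at this
    exact (mul_eq_zero.1 this).resolve_left hc0
  have uw : lorentz u (γ' 0) = 0 := by
    have := h.lorentz_velocity_curvature 0
    rw [hc, lorentz_smul_right, lorentz_comm] at this
    exact (mul_eq_zero.1 this).resolve_left hc0
  have e := h.eq_drill hu4 hK
  have c1 : ∀ s, lorentz (γ s) (γ 0) = cos s := fun s => by
    rw [e s, lorentz_add_left, lorentz_add_left, lorentz_smul_left, lorentz_smul_left,
      lorentz_smul_left, uv, h.unit, lorentz_comm, h.lorentz_velocity]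
    ring
  have c2 : ∀ s, lorentz (γ s) (γ' 0) = sin s := fun s => by
    rw [e s, lorentz_add_left, lorentz_add_left, lorentz_smul_left, lorentz_smul_left,
      lorentz_smul_left, uw, h.unit', h.lorentz_velocity]
    ring
  refine ⟨?_, fun s => ?_, hu, h.unit 0, h.unit' 0, uv, uw, h.lorentz_velocity 0, e⟩
  · have hc'' := h.continuous''
    exact contDiff_two_of_hasDerivAt
      (fun s => (((hasDerivAt_pi.1 (h.hasDerivAt s) 4).sub ((hasDerivAt_cos s).mul_const _)).sub
        ((hasDerivAt_sin s).mul_const _)).div_const _)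
      (fun s => (((hasDerivAt_pi.1 (h.hasDerivAt' s) 4).sub
        ((hasDerivAt_sin s).neg.mul_const _)).sub
        ((hasDerivAt_cos s).mul_const _)).div_const _) (by fun_prop)
  -- Cosine and sine are replaced by products of γ with fixed vectors, so the period l is inherited
  -- from γ.
  · simp only [← c1, ← c2, h.periodic s]

/-- The operator d²/ds² + 1 kills the circle and leaves only the u component. -/
theorem curvature_eq_of_isDrill (h : IsUnitSpeedCurve l γ γ' γ'' K) {lam : ℝ → ℝ}
    {u v w : Fin 5 → ℝ} (hd : IsDrill l γ lam u v w) (s : ℝ) :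
    K s = (lam s + deriv (deriv lam) s) • u := by
  obtain ⟨hlam, -, -, -, -, -, -, -, e⟩ := hd
  rw [show (2 : WithTop ℕ∞) = 1 + 1 from rfl, contDiff_succ_iff_deriv, contDiff_one_iff_deriv]
    at hlam
  have d1 : ∀ s, γ' s = deriv lam s • u + -sin s • v + cos s • w := fun s => by
    have h1 := h.hasDerivAt s
    rw [funext e] at h1
    exact h1.unique ((((hlam.1 s).hasDerivAt.smul_const u).add
      ((hasDerivAt_cos s).smul_const v)).add ((hasDerivAt_sin s).smul_const w))
  have d2 : γ'' s = deriv (deriv lam) s • u + -cos s • v + -sin s • w := by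
    have h1 := h.hasDerivAt' s
    rw [funext d1] at h1
    exact h1.unique ((((hlam.2.2.1 s).hasDerivAt.smul_const u).add
      ((hasDerivAt_sin s).neg.smul_const v)).add ((hasDerivAt_cos s).smul_const w))
  rw [h.curvature, d2, e]
  module

theorem exists_length_eq (h : IsUnitSpeedCurve l γ γ' γ'' K) {lam : ℝ → ℝ}
    {u v w : Fin 5 → ℝ} (hd : IsDrill l γ lam u v w) : ∃ k : ℕ, 1 ≤ k ∧ l = k * (2 * π) := by
  have h1 : cos l = 1 := by
    rw [← hd.lorentz_left, ← cos_zero, ← hd.lorentz_left, ← zero_add l, h.periodic 0]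
  obtain ⟨n, hn⟩ := (cos_eq_one_iff l).1 h1
  have hn0 : (0 : ℝ) < n := by
    have := h.pos
    rw [← hn] at this
    exact pos_of_mul_pos_left this two_pi_pos.le
  have hn0 : 0 < n := by exact_mod_cast hn0
  lift n to ℕ using hn0.le
  exact ⟨n, by omega, by rw [← hn]; simp⟩

/-- If the circle is run through at least twice, lam takes equal values at some s and s + 2π, and
the curve meets itself there. -/
theorem length_eq_of_injOn (h : IsUnitSpeedCurve l γ γ' γ'' K) {lam : ℝ → ℝ}
    {u v w : Fin 5 → ℝ} (hd : IsDrill l γ lam u v w) (hi : InjOn γ (Ico 0 l)) : l = 2 * π := by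
  obtain ⟨k, hk, e⟩ := h.exists_length_eq hd
  rcases hk.eq_or_lt with rfl | hk
  · simpa using e
  have hk2 : (2 : ℝ) ≤ k := by exact_mod_cast hk
  have hl : 2 * π < l := by rw [e]; nlinarith [pi_pos]
  exfalso
  obtain ⟨s, hs, es⟩ := exists_apply_add_eq h.pos hd.1.continuous hd.2.1 (2 * π)
  have eγ : γ (s + 2 * π) = γ s := by
    obtain ⟨-, -, -, -, -, -, -, -, e⟩ := hd
    rw [e, e, es, cos_add_two_pi, sin_add_two_pi]
  rcases lt_or_ge (s + 2 * π) l with hlt | hge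
  -- When s + 2π leaves the period interval it is replaced by s + 2π - l, which differs from s
  -- because 2π < l.
  · have := hi ⟨by linarith [hs.1, pi_pos], hlt⟩ hs eγ
    linarith [pi_pos]
  · have e' : γ (s + 2 * π - l) = γ s := by rw [h.periodic.sub_eq, eγ]
    have := hi ⟨by linarith, by linarith [hs.2]⟩ hs e'
    linarith

/-- Either the curve is longer than `2π`, or its curvature line is constant and light-like. -/
theorem two_pi_lt_or_isDrill (h : IsUnitSpeedCurve l γ γ' γ'' K) :
    2 * π < l ∨ ∃ lam u v w, IsDrill l γ lam u v w := by
  rcases h.lorentz_total_total_nonpos.lt_or_eq with hN | hN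
  · exact Or.inl (h.two_pi_lt_of_total_timelike hN)
  · refine Or.inr ⟨_, _, _, _, h.isDrill (u := total l K) ⟨fun h0 => ?_, hN⟩ fun s =>
      ⟨_, h.eq_smul_total hN s⟩⟩
    exact h.total_apply_four_ne_zero (by rw [h0]; rfl)

end IsUnitSpeedCurve

/-! ### Passing to the arc-length parameter -/

namespace IsClosedSpacelikeCurve

variable {T : ℝ} {σ : ℝ → Fin 5 → ℝ}

theorem contDiff_deriv (h : IsClosedSpacelikeCurve T σ) : ContDiff ℝ 1 (deriv σ) := by
  have := h.contDiff
  rw [show (2 : WithTop ℕ∞) = 1 + 1 from rfl, contDiff_succ_iff_deriv] at this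
  exact this.2.2

theorem contDiff_speed (h : IsClosedSpacelikeCurve T σ) : ContDiff ℝ 1 (speed σ) := by
  have := contDiff_pi.1 h.contDiff_deriv
  refine ContDiff.sqrt ?_ fun t => (h.spacelike t).ne'
  unfold lorentz
  exact (((((this 0).mul (this 0)).add ((this 1).mul (this 1))).add ((this 2).mul (this 2))).add
    ((this 3).mul (this 3))).sub ((this 4).mul (this 4))

theorem speed_pos (h : IsClosedSpacelikeCurve T σ) (t : ℝ) : 0 < speed σ t :=
  sqrt_pos.2 (h.spacelike t)

theorem hasDerivAt_arcLength (h : IsClosedSpacelikeCurve T σ) (t : ℝ) :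
    HasDerivAt (arcLength σ) (speed σ t) t :=
  have hc := h.contDiff_speed.continuous
  integral_hasDerivAt_right (hc.intervalIntegrable _ _)
    hc.aestronglyMeasurable.stronglyMeasurableAtFilter hc.continuousAt

theorem strictMono_arcLength (h : IsClosedSpacelikeCurve T σ) : StrictMono (arcLength σ) :=
  strictMono_of_deriv_pos fun t => by
    rw [(h.hasDerivAt_arcLength t).deriv]; exact h.speed_pos t

theorem periodic_deriv (h : IsClosedSpacelikeCurve T σ) : Function.Periodic (deriv σ) T :=
  fun t => by rw [← deriv_comp_add_const, funext h.periodic]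

theorem periodic_speed (h : IsClosedSpacelikeCurve T σ) : Function.Periodic (speed σ) T :=
  fun t => by rw [speed, speed, h.periodic_deriv t]

theorem arcLength_add (h : IsClosedSpacelikeCurve T σ) (t : ℝ) :
    arcLength σ (t + T) = arcLength σ t + length T σ := by
  have hc := h.contDiff_speed.continuous
  rw [arcLength, ← integral_add_adjacent_intervals (hc.intervalIntegrable 0 t)
    (hc.intervalIntegrable t _), h.periodic_speed.intervalIntegral_add_eq t 0, zero_add]
  rfl

/-- A positive periodic speed has an integral unbounded in both directions. -/
theorem surjective_arcLength (h : IsClosedSpacelikeCurve T σ) :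
    Function.Surjective (arcLength σ) := by
  have hc := h.contDiff_speed.continuous
  have hp : ∀ t₁ t₂, IntervalIntegrable (speed σ) MeasureTheory.volume t₁ t₂ := fun _ _ =>
    hc.intervalIntegrable _ _
  exact (continuous_iff_continuousAt.2 fun t => (h.hasDerivAt_arcLength t).continuousAt).surjective
    (h.periodic_speed.tendsto_atTop_intervalIntegral_of_pos' (hp _ _) h.speed_pos h.period_pos)
    (h.periodic_speed.tendsto_atBot_intervalIntegral_of_pos' (hp _ _) h.speed_pos h.period_pos)

theorem lorentz_arcDeriv (h : IsClosedSpacelikeCurve T σ) (t : ℝ) :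
    lorentz (arcDeriv σ σ t) (arcDeriv σ σ t) = 1 := by
  have h0 := (h.speed_pos t).ne'
  have h1 : lorentz (deriv σ t) (deriv σ t) = speed σ t * speed σ t :=
    (mul_self_sqrt (h.spacelike t).le).symm
  rw [arcDeriv, lorentz_smul_left, lorentz_smul_right, h1]
  field_simp

theorem contDiff_arcDeriv (h : IsClosedSpacelikeCurve T σ) : ContDiff ℝ 1 (arcDeriv σ σ) :=
  (h.contDiff_speed.inv fun t => (h.speed_pos t).ne').smul h.contDiff_deriv

/-- The reparametrization by arc length. -/
theorem exists_isUnitSpeedCurve (h : IsClosedSpacelikeCurve T σ) (hk : IsAlmostRegular σ) :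
    ∃ τ : ℝ → ℝ, (∀ s, arcLength σ (τ s) = s) ∧ (∀ t, τ (arcLength σ t) = t) ∧
      IsUnitSpeedCurve (length T σ) (σ ∘ τ) (arcDeriv σ σ ∘ τ) (arcDeriv σ (arcDeriv σ σ) ∘ τ)
        (geodesicCurvature σ ∘ τ) := by
  let o := h.strictMono_arcLength.orderIsoOfSurjective _ h.surjective_arcLength
  have ho : ∀ s, arcLength σ (o.symm s) = s := o.apply_symm_apply
  have ho' : ∀ t, o.symm (arcLength σ t) = t := o.symm_apply_apply
  have hτc : Continuous o.symm := o.symm.continuous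
  have hτ : ∀ s, HasDerivAt o.symm (speed σ (o.symm s))⁻¹ s := fun s =>
    (h.hasDerivAt_arcLength _).of_local_left_inverse hτc.continuousAt (h.speed_pos _).ne'
      (Eventually.of_forall ho)
  -- By the chain rule, the weight (speed)⁻¹ in `arcDeriv` is exactly the derivative of the inverse
  -- of arc length.
  have hcomp : ∀ f : ℝ → Fin 5 → ℝ, Differentiable ℝ f → ∀ s,
      HasDerivAt (f ∘ o.symm) ((arcDeriv σ f ∘ o.symm) s) s := fun f hf s =>
    (hf (o.symm s)).hasDerivAt.scomp s (hτ s)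
  refine ⟨o.symm, ho, ho', ?_, hcomp σ (h.contDiff.differentiable (by norm_num)),
    hcomp _ (h.contDiff_arcDeriv.differentiable (by norm_num)), ?_, fun s => ?_, fun s => h.mem _,
    fun s => h.lorentz_arcDeriv _, fun s => rfl, fun s => (hk _).1, fun s => (hk _).2⟩
  · have := h.strictMono_arcLength h.period_pos
    rwa [show arcLength σ 0 = 0 from integral_same] at this
  · exact Continuous.comp ((h.contDiff_speed.continuous.inv₀ fun t => (h.speed_pos t).ne').smul
      (h.contDiff_arcDeriv.continuous_deriv le_rfl)) hτc
  · have : o.symm (s + length T σ) = o.symm s + T := by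
      rw [← ho' (o.symm s + T), h.arcLength_add, ho]
    rw [Function.comp_apply, this, h.periodic, Function.comp_apply]

end IsClosedSpacelikeCurve

end DeSitter

/-! ### The theorem for an arbitrary regular parameter -/

open DeSitter in
theorem mainTheorem1 (T : ℝ) (σ : ℝ → Fin 5 → ℝ)
    (hσ : DeSitter.IsClosedSpacelikeCurve T σ) (hk : DeSitter.IsAlmostRegular σ) :
    2 * Real.pi ≤ DeSitter.length T σ ∧
    (DeSitter.length T σ = 2 * Real.pi ↔
      DeSitter.HasConstantLightlikeCurvatureLine σ ∧ DeSitter.IsSimpleClosed T σ) ∧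
    (DeSitter.HasConstantLightlikeCurvatureLine σ ↔ DeSitter.HasDrillForm T σ) ∧
    (DeSitter.HasConstantLightlikeCurvatureLine σ →
      ∃ k : ℕ, 1 ≤ k ∧ DeSitter.length T σ = k * (2 * Real.pi)) := by
  obtain ⟨τ, hτ, hτ', h⟩ := hσ.exists_isUnitSpeedCurve hk
  have hmono := hσ.strictMono_arcLength
  have h0 : arcLength σ 0 = 0 := integral_same
  have drill_iff : HasDrillForm T σ ↔
      ∃ lam u v w, IsDrill (DeSitter.length T σ) (σ ∘ τ) lam u v w := by
    constructor
    · rintro ⟨lam, u, v, w, h1, h2, h3, h4, h5, h6, h7, h8, e⟩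
      exact ⟨lam, u, v, w, h1, h2, h3, h4, h5, h6, h7, h8, fun s => by
        rw [Function.comp_apply, e, hτ]⟩
    · rintro ⟨lam, u, v, w, h1, h2, h3, h4, h5, h6, h7, h8, e⟩
      exact ⟨lam, u, v, w, h1, h2, h3, h4, h5, h6, h7, h8, fun t => by
        rw [← e, Function.comp_apply, hτ']⟩
  have simple_iff : IsSimpleClosed T σ ↔ InjOn (σ ∘ τ) (Ico 0 (DeSitter.length T σ)) := by
    constructor
    · intro hi s hs r hr e
      have key : ∀ s ∈ Ico 0 (DeSitter.length T σ), τ s ∈ Ico 0 T := fun s hs =>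
        ⟨hmono.le_iff_le.1 (by rw [hτ, h0]; exact hs.1),
          hmono.lt_iff_lt.1 (by rw [hτ]; exact hs.2)⟩
      rw [← hτ s, hi (key s hs) (key r hr) e, hτ]
    · intro hi t ht r hr e
      have key : ∀ t ∈ Ico 0 T, arcLength σ t ∈ Ico 0 (DeSitter.length T σ) := fun t ht =>
        ⟨by rw [← h0]; exact hmono.monotone ht.1, hmono ht.2⟩
      refine hmono.injective (hi (key t ht) (key r hr) ?_)
      simp only [Function.comp_apply, hτ', e]
  have const_iff : HasConstantLightlikeCurvatureLine σ ↔ HasDrillForm T σ := by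
    rw [drill_iff]
    constructor
    · rintro ⟨hl, hs⟩
      refine ⟨_, _, _, _, h.isDrill (hl 0) fun s => ?_⟩
      have : geodesicCurvature σ (τ s) ∈ Submodule.span ℝ {geodesicCurvature σ 0} := by
        rw [← hs (τ s) 0]; exact Submodule.mem_span_singleton_self _
      obtain ⟨c, hc⟩ := Submodule.mem_span_singleton.1 this
      exact ⟨c, hc.symm⟩
    · rintro ⟨lam, u, v, w, hd⟩
      -- The factor is nonzero because the geodesic curvature never vanishes; this makes each span
      -- equal to that of u.
      have key : ∀ t, ∃ c : ℝ, c ≠ 0 ∧ geodesicCurvature σ t = c • u := fun t => by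
        have e := h.curvature_eq_of_isDrill hd (arcLength σ t)
        rw [Function.comp_apply, hτ'] at e
        exact ⟨_, fun hc => (hk t).1 (by rw [e, hc, zero_smul]), e⟩
      have span_eq : ∀ t, Submodule.span ℝ {geodesicCurvature σ t} = Submodule.span ℝ {u} :=
        fun t => by
          obtain ⟨c, hc, e⟩ := key t
          rw [e, Submodule.span_singleton_smul_eq hc.isUnit]
      refine ⟨fun t => ⟨(hk t).1, ?_⟩, fun t₁ t₂ => by rw [span_eq, span_eq]⟩
      obtain ⟨c, -, e⟩ := key t
      rw [e, lorentz_smul_left, lorentz_smul_right, hd.2.2.1.2]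
      simp
  have mult : HasConstantLightlikeCurvatureLine σ →
      ∃ k : ℕ, 1 ≤ k ∧ DeSitter.length T σ = k * (2 * Real.pi) := fun hc => by
    obtain ⟨lam, u, v, w, hd⟩ := drill_iff.1 (const_iff.1 hc)
    exact h.exists_length_eq hd
  refine ⟨?_, ⟨fun hl => ?_, fun ⟨hc, hi⟩ => ?_⟩, const_iff, mult⟩
  · rcases h.two_pi_lt_or_isDrill with hlt | ⟨lam, u, v, w, hd⟩
    · exact hlt.le
    · obtain ⟨k, hk1, e⟩ := h.exists_length_eq hd
      have : (1 : ℝ) ≤ k := by exact_mod_cast hk1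
      rw [e]
      nlinarith [Real.pi_pos]
  · rcases h.two_pi_lt_or_isDrill with hlt | ⟨lam, u, v, w, hd⟩
    · exact absurd hl hlt.ne'
    · refine ⟨const_iff.2 (drill_iff.2 ⟨lam, u, v, w, hd⟩), simple_iff.2 ?_⟩
      rw [hl]
      exact hd.injOn
  · obtain ⟨lam, u, v, w, hd⟩ := drill_iff.1 (const_iff.1 hc)
    exact h.length_eq_of_injOn hd (simple_iff.1 hi)
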